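/- Let $k$ be an algebraically closed field of characteristic different from $2$, and let $E_1,E_2,E_1',E_2'$ be elliptic curves over $k$ with identity elements $\mathcal O_{E_1},\mathcal O_{E_2},\mathcal O_{E_1'},\mathcal O_{E_2'}$ and Weierstrass points (points of order two) $P_i,Q_i,P_i',Q_i'$, $i=1,2,3$, respectively. Products of elliptic curves carry the product polarization. A $(2,2)$-subgroup of a product $A$ of two elliptic curves is a subgroup of $A[2]$ that is isomorphic to $(\mathbb Z/2\mathbb Z)^2$ and maximal isotropic for the $2$-Weil pairing; a $(2,2)$-isogeny is a (separable) isogeny whose kernel is a $(2,2)$-subgroup. A $(2,2)$-isogeny $\phi_2\colon A_1\to A_2$ to an abelian variety $A_2$ is a good extension of a $(2,2)$-isogeny $\phi_1\colon A_0\to A_1$ if $\ker(\phi_2\circ\phi_1)\cong(\mathbb Z/4\mathbb Z)^2$. Let $\phi_1\colon E_1\times E_2\to E_1'\times E_2'$ be a $(2,2)$-isogeny with $$\ker(\phi_1)=\{(\mathcal O_{E_1},\mathcal O_{E_2}),(P_1,\mathcal O_{E_2}),(\mathcal O_{E_1},Q_1),(P_1,Q_1)\},$$ $\phi_1(P_2,\mathcal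 O_{E_2})=\phi_1(P_3,\mathcal O_{E_2})=(P_1',\mathcal O_{E_2'})$ and $\phi_1(\mathcal O_{E_1},Q_2)=\phi_1(\mathcal O_{E_1},Q_3)=(\mathcal O_{E_1'},Q_1')$. Then the good extensions of $\phi_1$ are exactly the separable isogenies from $E_1'\times E_2'$ to abelian varieties whose kernel is one of the 4 sets $$\{(\mathcal O_{E_1'},\mathcal O_{E_2'}),(P_i',\mathcal O_{E_2'}),(\mathcal O_{E_1'},Q_j'),(P_i',Q_j')\},\qquad i\neq 1,\ j\neq 1,$$ or one of the 4 sets $$\{(\mathcal O_{E_1'},\mathcal O_{E_2'}),(P_1',Q_2'),(P_2',Q_3'),(P_3',Q_1')\},$$ $$\{(\mathcal O_{E_1'},\mathcal O_{E_2'}),(P_1',Q_3'),(P_2',Q_1'),(P_3',Q_2')\},$$ $$\{(\mathcal O_{E_1'},\mathcal O_{E_2'}),(P_1',Q_2'),(P_2',Q_1'),(P_3',Q_3')\},$$ $$\{(\mathcal O_{E_1'},\mathcal O_{E_2'}),(P_1',Q_3'),(P_2',Q_2'),(P_3',Q_1')\}.$$ Equivalently, in terms of kernels: these 8 sets are pairwise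 distinct, and they are exactly the $(2,2)$-subgroups $K$ of $E_1'\times E_2'$ with $\phi_1^{-1}(K)\cong(\mathbb Z/4\mathbb Z)^2$. -/

import Mathlib

noncomputable section

namespace Isog

/-! ### Varieties in projective space, in the classical language

The base field `k` will always be algebraically closed, and varieties are identified with their sets
of `k`-points. -/

/-- A map from `A` to a projective space over `k`, given by a choice of homogeneous coordinates. All
notions below use homogeneous polynomials only, so they depend only on the resulting points of the
projective space and not on the choice of the representing vectors. -/
class ProjCoords (k : Type*) [Field k] (A : Type*) where
  /-- the set of homogeneous coordinates -/
  Idx : Type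
  finite_idx : Finite Idx
  /-- homogeneous coordinates of a point -/
  vec : A → Idx → k
  vec_ne_zero : ∀ a, vec a ≠ 0

/-- The product of two sets with projective coordinates, through the Segre embedding. -/
instance prodCoords (k : Type*) [Field k] (A B : Type*) [ProjCoords k A] [ProjCoords k B] :
    ProjCoords k (A × B) where
  Idx := ProjCoords.Idx k A × ProjCoords.Idx k B
  finite_idx := by
    have := ProjCoords.finite_idx (k := k) (A := A)
    have := ProjCoords.finite_idx (k := k) (A := B)
    infer_instance
  vec p := fun ij => ProjCoords.vec p.1 ij.1 * ProjCoords.vec p.2 ij.2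
  vec_ne_zero p := by
    obtain ⟨i, hi⟩ := Function.ne_iff.mp (ProjCoords.vec_ne_zero (k := k) p.1)
    obtain ⟨j, hj⟩ := Function.ne_iff.mp (ProjCoords.vec_ne_zero (k := k) p.2)
    exact Function.ne_iff.mpr ⟨(i, j), mul_ne_zero hi hj⟩

section Varieties

variable (k : Type*) [Field k] {A B : Type*} [ProjCoords k A] [ProjCoords k B]

/-- The value of a polynomial in the homogeneous coordinates at (the chosen coordinates of) `a`. -/
def valueAt (F : MvPolynomial (ProjCoords.Idx k A) k) (a : A) : k :=
  MvPolynomial.eval (ProjCoords.vec a) F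

/-- Zariski closed subsets: zero sets of families of homogeneous polynomials. -/
def IsZariskiClosed (Z : Set A) : Prop :=
  ∃ S : Set (MvPolynomial (ProjCoords.Idx k A) k),
    (∀ F ∈ S, ∃ d, F.IsHomogeneous d) ∧ Z = {a | ∀ F ∈ S, valueAt k F a = 0}

/-- Zariski open subsets. -/
def IsZariskiOpen (U : Set A) : Prop := IsZariskiClosed k Uᶜ

/-- `h` is a regular function on `U`: near every point of `U` it is a quotient of two homogeneous
polynomials of the same degree. Only the values of `h` on `U` matter. -/
def IsRegularOn (U : Set A) (h : A → k) : Prop :=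
  ∀ x ∈ U, ∃ (d : ℕ) (F G : MvPolynomial (ProjCoords.Idx k A) k),
    F.IsHomogeneous d ∧ G.IsHomogeneous d ∧ valueAt k G x ≠ 0 ∧
      ∀ y ∈ U, valueAt k G y ≠ 0 → h y = valueAt k F y / valueAt k G y

/-- Morphisms of varieties: Zariski continuous maps along which regular functions pull back to
regular functions. -/
def IsMorphism (f : A → B) : Prop :=
  (∀ V : Set B, IsZariskiOpen k V → IsZariskiOpen k (f ⁻¹' V)) ∧
    ∀ (V : Set B) (h : B → k), IsZariskiOpen k V → IsRegularOn k V h →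
      IsRegularOn k (f ⁻¹' V) (h ∘ f)

variable (A) in
/-- The coordinates embed `A` as an irreducible closed subset of projective space. -/
structure IsProjectiveVariety : Prop where
  nonempty : Nonempty A
  injective : ∀ a b : A, (∃ c : k, ProjCoords.vec (k := k) a = c • ProjCoords.vec b) → a = b
  isClosed : ∃ S : Set (MvPolynomial (ProjCoords.Idx k A) k),
    (∀ F ∈ S, ∃ d, F.IsHomogeneous d) ∧
      ∀ v : ProjCoords.Idx k A → k, v ≠ 0 →
        ((∃ (a : A) (c : k), v = c • ProjCoords.vec a) ↔ ∀ F ∈ S, MvPolynomial.eval v F = 0)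
  irreducible : ∀ Z₁ Z₂ : Set A, IsZariskiClosed k Z₁ → IsZariskiClosed k Z₂ →
    Z₁ ∪ Z₂ = Set.univ → Z₁ = Set.univ ∨ Z₂ = Set.univ

variable (A) in
/-- Abelian varieties: projective varieties with a group law given by morphisms. -/
structure IsAbelianVariety [AddCommGroup A] : Prop where
  isProjectiveVariety : IsProjectiveVariety k A
  add : IsMorphism k (fun p : A × A => p.1 + p.2)
  neg : IsMorphism k (fun a : A => -a)

/-- Separable isogenies: surjective homomorphisms with finite kernel that are morphisms of varieties
and through which the target carries the structure of the quotient variety, that is, a function on an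
open subset of the target is regular as soon as its pullback is. (The last condition excludes
Frobenius factors; it says that the target is the quotient of `A` by the group of `k`-points of the
kernel.) -/
structure IsSeparableIsogeny [AddCommGroup A] [AddCommGroup B] (φ : A →+ B) : Prop where
  surjective : Function.Surjective φ
  finite_ker : (φ.ker : Set A).Finite
  isMorphism : IsMorphism k φ
  isQuotient : ∀ (V : Set B) (h : B → k), IsZariskiOpen k V →
    IsRegularOn k (φ ⁻¹' V) (h ∘ φ) → IsRegularOn k V h

end Varieties

/-! ### Elliptic curves and the 2-Weil pairing -/

section Elliptic

variable {k : Type*} [Field k]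

/-- The points of a Weierstrass curve over its base field. -/
abbrev Pts (E : WeierstrassCurve k) : Type _ := E.toAffine.Point

/-- Points of a Weierstrass curve as points of the projective plane: the point at infinity is
`[0 : 1 : 0]` and `(x, y)` is `[x : y : 1]`. -/
instance ptsCoords (E : WeierstrassCurve k) : ProjCoords k (Pts E) where
  Idx := Fin 3
  finite_idx := inferInstance
  vec
    | .zero => ![0, 1, 0]
    | .some x y _ => ![x, y, 1]
  vec_ne_zero
    | .zero => Function.ne_iff.mpr ⟨1, by simp⟩
    | .some _ _ _ => Function.ne_iff.mpr ⟨2, by simp⟩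

variable [DecidableEq k]

/-- `P` numbers the Weierstrass points of `E`, i.e. the points other than `O` that are fixed by
negation. -/
def IsWeierstrassNumbering (E : WeierstrassCurve k) (P : Fin 3 → Pts E) : Prop :=
  Function.Injective P ∧ Set.range P = {T | T ≠ 0 ∧ 2 • T = 0}

/-- For a point `S` of order two, the value at `X` of the function `x - x(S)`, whose divisor is
`2 (S) - 2 (O)`; for `S = O` the constant function `1`. (The value at the pole `X = O` is junk.) -/
def vert {E : WeierstrassCurve k} (S X : Pts E) : k :=
  match S, X with
  | .some x _ _, .some x' _ _ => x' - x
  | _, _ => 1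

/-- The quotient `(f_S(T + X) / f_S(X)) / (f_T(S - X) / f_T(-X))`, where `f_S` has divisor
`2 (S) - 2 (O)` and `f_T` has divisor `2 (T) - 2 (O)`. -/
def weilRatio {E : WeierstrassCurve k} (S T X : Pts E) : k :=
  (vert S (T + X) / vert S X) / (vert T (S - X) / vert T (-X))

/-- The 2-Weil pairing of two 2-torsion points: the value of `weilRatio S T X` at an auxiliary point
`X` that is not a 2-torsion point (the value does not depend on `X`). -/
def weilTwo {E : WeierstrassCurve k} (S T : Pts E) : k :=
  weilRatio S T (Classical.epsilon fun X : Pts E => 2 • X ≠ 0)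

/-- The 2-Weil pairing of `E₁ × E₂` with respect to the product polarization. -/
def weilTwoProd {E₁ E₂ : WeierstrassCurve k} (s t : Pts E₁ × Pts E₂) : k :=
  weilTwo s.1 t.1 * weilTwo s.2 t.2

/-- A subgroup of `(E₁ × E₂)[2]` on which the 2-Weil pairing is trivial. -/
def IsIsotropic {E₁ E₂ : WeierstrassCurve k} (K : AddSubgroup (Pts E₁ × Pts E₂)) : Prop :=
  (∀ s ∈ K, 2 • s = 0) ∧ ∀ s ∈ K, ∀ t ∈ K, weilTwoProd s t = 1

/-- `(2,2)`-subgroups of `E₁ × E₂`: maximal isotropic for the 2-Weil pairing and isomorphic to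
`ℤ/2 × ℤ/2`. -/
def IsTwoTwoSubgroup {E₁ E₂ : WeierstrassCurve k} (K : AddSubgroup (Pts E₁ × Pts E₂)) : Prop :=
  Maximal IsIsotropic K ∧ Nonempty (K ≃+ ZMod 2 × ZMod 2)

/-- `(2,2)`-isogenies with domain `E₁ × E₂`: isogenies whose kernel is a `(2,2)`-subgroup. -/
def IsTwoTwoIsogeny {E₁ E₂ : WeierstrassCurve k} {B : Type*} [AddCommGroup B] [ProjCoords k B]
    (φ : Pts E₁ × Pts E₂ →+ B) : Prop :=
  IsSeparableIsogeny k φ ∧ IsTwoTwoSubgroup φ.ker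

/-- `φ₂` is a good extension of `φ₁`: both are `(2,2)`-isogenies and the kernel of the composition
is isomorphic to `ℤ/4 × ℤ/4`. -/
def IsGoodExtension {E₁ E₂ E₁' E₂' : WeierstrassCurve k} {B : Type*} [AddCommGroup B]
    [ProjCoords k B] (φ₁ : Pts E₁ × Pts E₂ →+ Pts E₁' × Pts E₂')
    (φ₂ : Pts E₁' × Pts E₂' →+ B) : Prop :=
  IsTwoTwoIsogeny φ₁ ∧ IsTwoTwoIsogeny φ₂ ∧ Nonempty ((φ₂.comp φ₁).ker ≃+ ZMod 4 × ZMod 4)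

end Elliptic

/-- The eight sets in the classification; the indices `0, 1, 2` stand for `1, 2, 3`. -/
def goodKernels {A B : Type*} [Zero A] [Zero B] (P : Fin 3 → A) (Q : Fin 3 → B) :
    Set (Set (A × B)) :=
  {S | ∃ i j : Fin 3, i ≠ 0 ∧ j ≠ 0 ∧ S = {(0, 0), (P i, 0), (0, Q j), (P i, Q j)}} ∪
  {{(0, 0), (P 0, Q 1), (P 1, Q 2), (P 2, Q 0)},
   {(0, 0), (P 0, Q 2), (P 1, Q 0), (P 2, Q 1)},
   {(0, 0), (P 0, Q 1), (P 1, Q 0), (P 2, Q 2)},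
   {(0, 0), (P 0, Q 2), (P 1, Q 1), (P 2, Q 0)}}

end Isog

end

/-!
All the conditions in question only see finite groups of torsion points.

Write `A = E₁ × E₂` and `B = E₁' × E₂'`. Let `K` be a `(2,2)`-subgroup of `B`. The preimage of `K`
has order `16` and is killed by `4`, so it is isomorphic to `(ℤ/4)²` if and only if its `2`-torsion
is no larger than `ker φ₁`, that is, if and only if `K` meets `φ₁(A[2])` only in `0`
(`comap_equiv_zmod_four_iff`, which needs `φ₁` to be surjective). The given values of `φ₁` show that
`φ₁(A[2])` is the plane `{0, (P₁', 0), (0, Q₁'), (P₁', Q₁')}` (`image_two_torsion`).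

It remains to find the maximal isotropic planes that are complements of this one. The `2`-Weil
pairing of an elliptic curve is computed from its definition as a quotient of values of `x`-coordinate
functions: it is `1` if the two arguments are dependent and `-1` otherwise (`weilTwo_eq`, from the
identity `vert_add_mul_vert`). The characteristic enters here through `-1 ≠ 1`. Hence a choice of
coordinates identifies `B[2]` with `(ℤ/2)⁴` and the Weil pairing with the sum of two determinants
(`exists_isTorsionCoord`). In this symplectic space of `16` elements, `IsTorsionCoord.twoTwo_iff`
reduces the claim to a finite check: the isotropic planes are the nine products of lines and the six
graphs of isomorphisms between the two factors, and four planes of each kind are complements.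
-/

namespace Isog

/-! ### Homomorphisms out of `ℤ/n × ℤ/n` -/

/-- Two elements killed by `n` are the images of the standard generators under a homomorphism. -/
theorem exists_hom_zmod_prod {A : Type*} [AddCommGroup A] (n : ℕ) (u v : A) (hu : n • u = 0)
    (hv : n • v = 0) : ∃ g : ZMod n × ZMod n →+ A, g (1, 0) = u ∧ g (0, 1) = v := by
  refine ⟨(ZMod.lift n ⟨zmultiplesHom A u, by simpa using hu⟩).coprod
    (ZMod.lift n ⟨zmultiplesHom A v, by simpa using hv⟩), ?_, ?_⟩
  · have := ZMod.lift_coe n ⟨zmultiplesHom A u, by simpa using hu⟩ 1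
    simp_all
  · have := ZMod.lift_coe n ⟨zmultiplesHom A v, by simpa using hv⟩ 1
    simp_all

theorem hom_zmod_prod_ext {A : Type*} [AddCommGroup A] {n : ℕ} {f g : ZMod n × ZMod n →+ A}
    (h₁ : f (1, 0) = g (1, 0)) (h₂ : f (0, 1) = g (0, 1)) : f = g := by
  have key : ∀ F G : ZMod n →+ A, F 1 = G 1 → F = G := fun F G h => by
    refine AddMonoidHom.ext fun x => ?_
    obtain ⟨m, rfl⟩ := ZMod.intCast_surjective x
    have e : (m : ZMod n) = m • (1 : ZMod n) := by simp
    rw [e, map_zsmul, map_zsmul, h]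
  have hl := key (f.comp (AddMonoidHom.inl _ _)) (g.comp (AddMonoidHom.inl _ _)) h₁
  have hr := key (f.comp (AddMonoidHom.inr _ _)) (g.comp (AddMonoidHom.inr _ _)) h₂
  rw [← AddMonoidHom.coprod_unique f, ← AddMonoidHom.coprod_unique g, hl, hr]

/-- Let `f` be surjective with a kernel of order four killed by `2`, and let `K ≅ (ℤ/2)²`. The
preimage of `K` has order `16` and is killed by `4`, so it is `(ℤ/4)²` exactly when its `2`-torsion
is as small as possible, that is, when it is the kernel of `f`. -/
theorem comap_equiv_zmod_four_iff {A B : Type*} [AddCommGroup A] [AddCommGroup B] (f : A →+ B)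
    (hf : Function.Surjective f) (hcard : (f.ker : Set A).ncard = 4)
    (hker : ∀ x, f x = 0 → 2 • x = 0) (K : AddSubgroup B) (e : K ≃+ ZMod 2 × ZMod 2) :
    Nonempty (K.comap f ≃+ ZMod 4 × ZMod 4) ↔ ∀ v, 2 • v = 0 → f v ∈ K → f v = 0 := by
  have hK : ∀ s ∈ K, 2 • s = 0 := by
    intro s hs
    have h0 : ∀ p : ZMod 2 × ZMod 2, 2 • p = 0 := by decide
    have h1 : (2 • (⟨s, hs⟩ : K)) = 0 := e.injective (by rw [map_nsmul, h0, map_zero])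
    simpa using congrArg Subtype.val h1
  constructor
  · -- in `(ℤ/4)²` every element killed by `2` is divisible by `2`
    rintro ⟨e'⟩ v hv hvK
    have hdiv : ∀ p : ZMod 4 × ZMod 4, 2 • p = 0 → ∃ r, p = 2 • r := by decide
    have h1 : 2 • (⟨v, hvK⟩ : K.comap f) = 0 := Subtype.ext (by simpa using hv)
    obtain ⟨r, hr⟩ := hdiv (e' ⟨v, hvK⟩) (by rw [← map_nsmul, h1, map_zero])
    have h2 : (⟨v, hvK⟩ : K.comap f) = 2 • e'.symm r := by
      apply e'.injective
      rw [hr, map_nsmul, e'.apply_symm_apply]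
    have h3 : v = 2 • (e'.symm r : A) := by simpa using congrArg Subtype.val h2
    rw [h3, map_nsmul]
    exact hK _ (e'.symm r).2
  · intro h
    -- lifts of two generators of `K` generate the preimage freely over `ℤ/4`
    obtain ⟨u, hu⟩ := hf (e.symm (1, 0))
    obtain ⟨v, hv⟩ := hf (e.symm (0, 1))
    have four : ∀ w, f w ∈ K → 4 • w = 0 := fun w hw => by
      have : f (2 • w) = 0 := by rw [map_nsmul]; exact hK _ hw
      simpa [← mul_nsmul] using hker _ this
    obtain ⟨g, hg₁, hg₂⟩ := exists_hom_zmod_prod 4 u v (four u (hu ▸ (e.symm _).2))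
      (four v (hv ▸ (e.symm _).2))
    let c₀ : ZMod 4 →+ ZMod 2 := (ZMod.castHom (by norm_num : 2 ∣ 4) (ZMod 2)).toAddMonoidHom
    let c : ZMod 4 × ZMod 4 →+ ZMod 2 × ZMod 2 := c₀.prodMap c₀
    have hfg : ∀ p, f (g p) = e.symm (c p) := by
      have : f.comp g = (K.subtype.comp (e.symm : ZMod 2 × ZMod 2 →+ K)).comp c := by
        apply hom_zmod_prod_ext
        · have : c (1, 0) = (1, 0) := by decide
          simp [hg₁, hu, this]
        · have : c (0, 1) = (0, 1) := by decide
          simp [hg₂, hv, this]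
      exact DFunLike.congr_fun this
    have hfgK : ∀ p, f (g p) ∈ K := fun p => by rw [hfg]; exact (e.symm _).2
    -- a nontrivial kernel would contain a nonzero element killed by `2`
    have two : ∀ r, g (2 • r) = 0 → 2 • r = 0 := fun r hr => by
      have h1 := h (g r) (by rw [← map_nsmul, hr]) (hfgK r)
      rw [hfg] at h1
      have h2 : c r = 0 := by simpa using h1
      have h3 : ∀ r, c r = 0 → 2 • r = 0 := by decide
      exact h3 r h2
    have hinj : Function.Injective g := by
      rw [injective_iff_map_eq_zero]
      intro p hp
      have h1 := two p (by rw [map_nsmul, hp, smul_zero])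
      have hdiv : ∀ p : ZMod 4 × ZMod 4, 2 • p = 0 → ∃ r, p = 2 • r := by decide
      obtain ⟨r, rfl⟩ := hdiv p h1
      exact two r hp
    have hkerg : g '' {p | c p = 0} = (f.ker : Set A) := by
      refine Set.eq_of_subset_of_ncard_le ?_ ?_ (Set.finite_of_ncard_ne_zero (by rw [hcard]; simp))
      · rintro _ ⟨p, hp, rfl⟩
        replace hp : c p = 0 := hp
        simp [AddMonoidHom.mem_ker, hfg, hp]
      · have h4 : (Finset.univ.filter fun p => c p = 0).card = 4 := by decide
        rw [Set.ncard_image_of_injective _ hinj, hcard]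
        refine h4.symm.le.trans (le_of_eq ?_)
        rw [← Set.ncard_coe_finset]
        simp
    have hrange : g.range = K.comap f := by
      ext x
      constructor
      · rintro ⟨p, rfl⟩
        exact hfgK p
      · intro hx
        have hc : Function.Surjective c := by decide
        obtain ⟨p, hp⟩ := hc (e ⟨f x, hx⟩)
        have hmem : x - g p ∈ (f.ker : Set A) := by
          simp [AddMonoidHom.mem_ker, hfg, hp]
        rw [← hkerg] at hmem
        obtain ⟨q, -, hq⟩ := hmem
        exact ⟨q + p, by rw [map_add, hq, sub_add_cancel]⟩
    exact ⟨((AddMonoidHom.ofInjective hinj).trans (AddEquiv.addSubgroupCongr hrange)).symm⟩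

/-! ### The 2-torsion and the 2-Weil pairing of an elliptic curve -/

section Pairing

variable {k : Type*} [Field k] {E : WeierstrassCurve k}

theorem neg_eq_of_two_nsmul {A : Type*} [AddCommGroup A] {S : A} (hS : 2 • S = 0) : -S = S := by
  rw [two_nsmul] at hS
  exact neg_eq_of_add_eq_zero_left hS

theorem vert_neg (S X : Pts E) : vert S (-X) = vert S X := by
  rcases S with _ | ⟨s, s', hs⟩ <;> rcases X with _ | ⟨x, y, hx⟩ <;> rfl

theorem vert_zero_left (X : Pts E) : vert 0 X = 1 := by
  rcases X with _ | ⟨x, y, hx⟩ <;> rfl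

/-- If `(t, t')` is a point of order two of a Weierstrass curve, then
`(x((t, t') + (x, y)) - t) (x - t)` does not depend on the point `(x, y)`. -/
theorem slope_translate {a₁ a₂ a₃ a₄ a₆ x y t t' : k} (h : x - t ≠ 0)
    (ht : t' ^ 2 + a₁ * t * t' + a₃ * t' = t ^ 3 + a₂ * t ^ 2 + a₄ * t + a₆)
    (hx : y ^ 2 + a₁ * x * y + a₃ * y = x ^ 3 + a₂ * x ^ 2 + a₄ * x + a₆)
    (ht' : 2 * t' + a₁ * t + a₃ = 0) :
    (((t' - y) / (t - x)) ^ 2 + a₁ * ((t' - y) / (t - x)) - a₂ - t - x - t) * (x - t) =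
      3 * t ^ 2 + 2 * a₂ * t + a₄ - a₁ * t' := by
  have h' : t - x ≠ 0 := fun e => h (by linear_combination -e)
  field_simp
  linear_combination (t - x) * (ht - hx + (y - t') * ht')

/-- The constants of `slope_translate` for two points of order two add up to `(t - s) ^ 2`. -/
theorem double_root_sum (h2 : (2 : k) ≠ 0) {a₁ a₂ a₃ a₄ a₆ s s' t t' : k} (h : t - s ≠ 0)
    (hs : s' ^ 2 + a₁ * s * s' + a₃ * s' = s ^ 3 + a₂ * s ^ 2 + a₄ * s + a₆)
    (ht : t' ^ 2 + a₁ * t * t' + a₃ * t' = t ^ 3 + a₂ * t ^ 2 + a₄ * t + a₆)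
    (hs' : 2 * s' + a₁ * s + a₃ = 0) (ht' : 2 * t' + a₁ * t + a₃ = 0) :
    3 * t ^ 2 + 2 * a₂ * t + a₄ - a₁ * t' + (3 * s ^ 2 + 2 * a₂ * s + a₄ - a₁ * s') =
      (t - s) ^ 2 := by
  apply mul_left_cancel₀ (mul_ne_zero h2 h)
  linear_combination (2 * t' + a₁ * t + a₃) * ht' - 4 * ht - (2 * s' + a₁ * s + a₃) * hs' +
    4 * hs - a₁ * (t - s) * (ht' + hs')

variable [DecidableEq k]

/-- The `2`-torsion of an elliptic curve with numbered Weierstrass points is `(ℤ/2)²`. -/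
theorem IsWeierstrassNumbering.exists_hom {P : Fin 3 → Pts E} (hP : IsWeierstrassNumbering E P) :
    ∃ ι : ZMod 2 × ZMod 2 →+ Pts E, Function.Injective ι ∧ (∀ T, 2 • T = 0 ↔ ∃ a, ι a = T) ∧
      ι (1, 0) = P 0 ∧ ι (0, 1) = P 1 ∧ ι (1, 1) = P 2 := by
  obtain ⟨hinj, hrange⟩ := hP
  have hmem : ∀ i, P i ≠ 0 ∧ 2 • P i = 0 := fun i =>
    (Set.ext_iff.mp hrange _).mp (Set.mem_range_self i)
  have h01 : P 0 ≠ P 1 := hinj.ne (by decide)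
  obtain ⟨ι, h10, h01'⟩ := exists_hom_zmod_prod 2 (P 0) (P 1) (hmem 0).2 (hmem 1).2
  have h11 : ι (1, 1) = P 0 + P 1 := by
    rw [← h10, ← h01', ← map_add]; rfl
  -- the sum of two distinct Weierstrass points is the third one
  have h2 : P 0 + P 1 = P 2 := by
    have hs : P 0 + P 1 ∈ Set.range P := by
      rw [hrange]
      refine ⟨fun h => h01 ?_, by rw [smul_add, (hmem 0).2, (hmem 1).2, add_zero]⟩
      have h1 := (hmem 1).2
      rw [two_nsmul] at h1
      exact add_right_cancel (h.trans h1.symm)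
    obtain ⟨i, hi⟩ := hs
    fin_cases i
    · exact absurd (by simpa using hi) (hmem 1).1
    · exact absurd (by simpa using hi) (hmem 0).1
    · exact hi.symm
  rw [h2] at h11
  refine ⟨ι, ?_, ?_, h10, h01', h11⟩
  · rw [injective_iff_map_eq_zero]
    intro a ha
    have cases : ∀ a : ZMod 2 × ZMod 2, a = 0 ∨ a = (1, 0) ∨ a = (0, 1) ∨ a = (1, 1) := by decide
    rcases cases a with rfl | rfl | rfl | rfl
    · rfl
    · exact absurd (h10 ▸ ha) (hmem 0).1
    · exact absurd (h01' ▸ ha) (hmem 1).1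
    · exact absurd (h11 ▸ ha) (hmem 2).1
  · intro T
    constructor
    · intro hT
      by_cases h0 : T = 0
      · exact ⟨0, by rw [h0, map_zero]⟩
      · obtain ⟨i, rfl⟩ : T ∈ Set.range P := (Set.ext_iff.mp hrange _).mpr ⟨h0, hT⟩
        fin_cases i
        exacts [⟨_, h10⟩, ⟨_, h01'⟩, ⟨_, h11⟩]
    · rintro ⟨a, rfl⟩
      have : ∀ a : ZMod 2 × ZMod 2, 2 • a = 0 := by decide
      rw [← map_nsmul, this, map_zero]

/-- There is an auxiliary point at which the Weil pairing can be evaluated: over an algebraically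
closed field there are infinitely many points, but only finitely many of them are killed by `2`. -/
theorem exists_two_nsmul_ne_zero [IsAlgClosed k] [E.IsElliptic] {P : Fin 3 → Pts E}
    (hP : IsWeierstrassNumbering E P) : ∃ X : Pts E, 2 • X ≠ 0 := by
  let xs : Pts E → k
    | .zero => 0
    | .some x _ _ => x
  have := IsAlgClosed.instInfinite (K := k)
  obtain ⟨x, hx⟩ := Infinite.exists_notMem_finset (Finset.univ.image fun i => xs (P i))
  open Polynomial in
  obtain ⟨y, hy⟩ : ∃ y, E.toAffine.Equation x y := by
    obtain ⟨y, hy⟩ := IsAlgClosed.exists_root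
      (X ^ 2 + C (E.a₁ * x + E.a₃) * X - C (x ^ 3 + E.a₂ * x ^ 2 + E.a₄ * x + E.a₆))
      (ne_of_eq_of_ne (b := 2) (by compute_degree!) (by decide))
    refine ⟨y, ?_⟩
    rw [WeierstrassCurve.Affine.equation_iff']
    simp only [IsRoot.def, eval_sub, eval_add, eval_mul, eval_pow, eval_X, eval_C] at hy
    linear_combination hy
  refine ⟨.some x y (WeierstrassCurve.Affine.equation_iff_nonsingular.mp hy), fun h => hx ?_⟩
  obtain ⟨i, hi⟩ := (Set.ext_iff.mp hP.2 _).mpr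
    ⟨WeierstrassCurve.Affine.Point.some_ne_zero _, h⟩
  exact Finset.mem_image.mpr ⟨i, Finset.mem_univ _, by rw [hi]⟩

/-- The function `x - x(S)` has no zero besides `S`. -/
theorem vert_ne_zero {S X : Pts E} (hS : 2 • S = 0) (h : X ≠ S) : vert S X ≠ 0 := by
  rcases S with _ | ⟨s, s', hs⟩ <;> rcases X with _ | ⟨x, y, hx⟩
  · exact one_ne_zero
  · exact one_ne_zero
  · exact one_ne_zero
  · intro h0
    rcases (WeierstrassCurve.Affine.Point.X_eq_iff (h₁ := hx) (h₂ := hs)).mp (sub_eq_zero.mp h0) with h1 | h1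
    · exact h h1
    · exact h (h1.trans (neg_eq_of_two_nsmul hS))

theorem vert_sub_eq {S T X : Pts E} (hS : 2 • S = 0) : vert T (S - X) = vert T (S + X) := by
  rw [← vert_neg, neg_sub, sub_eq_add_neg, neg_eq_of_two_nsmul hS, add_comm]

/-- For distinct points `S`, `T` of order two, the functions `(x(T + X) - x(S)) (x(X) - x(T))` and
`(x(S + X) - x(T)) (x(X) - x(S))` are opposite: if `U` is the third point of order two, they are
`(x(T) - x(S)) (x(X) - x(U))` and `(x(S) - x(T)) (x(X) - x(U))`. -/
theorem vert_add_mul_vert (h2 : (2 : k) ≠ 0) {S T X : Pts E} (hS : 2 • S = 0) (hT : 2 • T = 0)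
    (hS0 : S ≠ 0) (hT0 : T ≠ 0) (hST : S ≠ T) (hX : 2 • X ≠ 0) :
    vert S (T + X) * vert T X = -(vert T (S + X) * vert S X) := by
  have hXS : vert S X ≠ 0 := vert_ne_zero hS (by rintro rfl; exact hX hS)
  have hXT : vert T X ≠ 0 := vert_ne_zero hT (by rintro rfl; exact hX hT)
  have hTS : vert S T ≠ 0 := vert_ne_zero hS hST.symm
  have hnS := neg_eq_of_two_nsmul hS
  have hnT := neg_eq_of_two_nsmul hT
  rcases S with _ | ⟨s, s', hs⟩
  · exact absurd rfl hS0
  rcases T with _ | ⟨t, t', ht⟩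
  · exact absurd rfl hT0
  rcases X with _ | ⟨x, y, hx⟩
  · exact absurd (smul_zero 2) hX
  replace hXS : x - s ≠ 0 := hXS
  replace hXT : x - t ≠ 0 := hXT
  replace hTS : t - s ≠ 0 := hTS
  rw [WeierstrassCurve.Affine.Point.neg_some, WeierstrassCurve.Affine.Point.some.injEq] at hnS hnT
  have ys := hnS.2
  have yt := hnT.2
  simp only [WeierstrassCurve.Affine.negY] at ys yt
  rw [WeierstrassCurve.Affine.Point.add_of_X_ne (fun h => hXS (sub_eq_zero.mpr h.symm)),
    WeierstrassCurve.Affine.Point.add_of_X_ne (fun h => hXT (sub_eq_zero.mpr h.symm))]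
  simp only [vert, WeierstrassCurve.Affine.addX]
  rw [WeierstrassCurve.Affine.slope_of_X_ne (fun h => hXS (sub_eq_zero.mpr h.symm)),
    WeierstrassCurve.Affine.slope_of_X_ne (fun h => hXT (sub_eq_zero.mpr h.symm))]
  have eS := (E.toAffine.equation_iff _ _).mp hs.1
  have eT := (E.toAffine.equation_iff _ _).mp ht.1
  have eX := (E.toAffine.equation_iff _ _).mp hx.1
  have key := double_root_sum h2 hTS eS eT (by linear_combination -ys) (by linear_combination -yt)
  have kT := slope_translate hXT eT eX (by linear_combination -yt)
  have kS := slope_translate hXS eS eX (by linear_combination -ys)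
  linear_combination kT + kS + key

/-- The value of the `2`-Weil pairing on the `2`-torsion, in coordinates `ι : (ℤ/2)² → E`. -/
theorem weilTwo_eq (h2 : (2 : k) ≠ 0) (hE : ∃ X : Pts E, 2 • X ≠ 0) {S T : Pts E}
    (hS : 2 • S = 0) (hT : 2 • T = 0) :
    weilTwo S T = if S = 0 ∨ T = 0 ∨ S = T then 1 else -1 := by
  have hX : 2 • (Classical.epsilon fun X : Pts E => 2 • X ≠ 0) ≠ 0 := Classical.epsilon_spec hE
  rw [weilTwo]
  generalize (Classical.epsilon fun X : Pts E => 2 • X ≠ 0) = X at hX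
  have hne : ∀ R R' : Pts E, 2 • R = 0 → 2 • R' = 0 → R + X ≠ R' := fun R R' hR hR' h => hX (by
    rw [← h, smul_add, hR, zero_add] at hR'; exact hR')
  have hSX : vert S X ≠ 0 := vert_ne_zero hS (by rintro rfl; exact hX hS)
  have hTX : vert T X ≠ 0 := vert_ne_zero hT (by rintro rfl; exact hX hT)
  have hTSX : vert T (S + X) ≠ 0 := vert_ne_zero hT (hne S T hS hT)
  rw [weilRatio, vert_neg, vert_sub_eq hS]
  split_ifs with h
  · rcases h with rfl | rfl | rfl
    · simp [vert_zero_left, hTX]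
    · simp [vert_zero_left, hSX]
    · exact div_self (div_ne_zero hTSX hSX)
  · push Not at h
    have key := vert_add_mul_vert h2 hS hT h.1 h.2.1 h.2.2 hX
    field_simp
    linear_combination key

end Pairing

/-! ### Maximal isotropic subgroups in coordinates -/

/-- A product of two elliptic curves restricted to its `2`-torsion, as `(ℤ/2)² × (ℤ/2)²`. -/
abbrev TwoTorsion : Type := (ZMod 2 × ZMod 2) × (ZMod 2 × ZMod 2)

-- Named instances keep the instance searches of the finite checks below short.
instance TwoTorsion.instFintype : Fintype TwoTorsion := inferInstance

instance TwoTorsion.instDecidableEq : DecidableEq TwoTorsion := inferInstance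

/-- The additive form of the `2`-Weil pairing of the product polarization in the coordinates of
`TwoTorsion`: the sum of the determinants of the two factors. -/
def pairing (a b : TwoTorsion) : ZMod 2 :=
  (a.1.1 * b.1.2 + a.1.2 * b.1.1) + (a.2.1 * b.2.2 + a.2.2 * b.2.1)

/-- The coordinates of the three Weierstrass points. -/
def weierstrassCoord : Fin 3 → ZMod 2 × ZMod 2 := ![(1, 0), (0, 1), (1, 1)]

/-- The eight sets of `goodKernels` in the coordinates of `TwoTorsion`. -/
def goodFinsets : Finset (Finset TwoTorsion) :=
  let p := weierstrassCoord
  {{(0, 0), (p 1, 0), (0, p 1), (p 1, p 1)}, {(0, 0), (p 1, 0), (0, p 2), (p 1, p 2)},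
   {(0, 0), (p 2, 0), (0, p 1), (p 2, p 1)}, {(0, 0), (p 2, 0), (0, p 2), (p 2, p 2)},
   {(0, 0), (p 0, p 1), (p 1, p 2), (p 2, p 0)}, {(0, 0), (p 0, p 2), (p 1, p 0), (p 2, p 1)},
   {(0, 0), (p 0, p 1), (p 1, p 0), (p 2, p 2)}, {(0, 0), (p 0, p 2), (p 1, p 1), (p 2, p 0)}}

/-- The points `O` and `P₁` of the two factors span the image of the `2`-torsion under the first
isogeny. -/
def imageFinset : Finset TwoTorsion :=
  {((0, 0), (0, 0)), ((1, 0), (0, 0)), ((0, 0), (1, 0)), ((1, 0), (1, 0))}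

theorem card_goodFinsets : goodFinsets.card = 8 := by decide

theorem exists_span_of_mem_goodFinsets : ∀ T ∈ goodFinsets, ∃ s t : TwoTorsion,
    s ≠ 0 ∧ t ≠ 0 ∧ s ≠ t ∧ pairing s t = 0 ∧ s ∉ imageFinset ∧ t ∉ imageFinset ∧
      s + t ∉ imageFinset ∧ T = {0, s, t, s + t} := by
  intro T hT
  let p := weierstrassCoord
  simp only [goodFinsets, Finset.mem_insert, Finset.mem_singleton] at hT
  rcases hT with rfl | rfl | rfl | rfl | rfl | rfl | rfl | rfl
  · exact ⟨(p 1, 0), (0, p 1), by decide⟩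
  · exact ⟨(p 1, 0), (0, p 2), by decide⟩
  · exact ⟨(p 2, 0), (0, p 1), by decide⟩
  · exact ⟨(p 2, 0), (0, p 2), by decide⟩
  · exact ⟨(p 0, p 1), (p 1, p 2), by decide⟩
  · exact ⟨(p 0, p 2), (p 1, p 0), by decide⟩
  · exact ⟨(p 0, p 1), (p 1, p 0), by decide⟩
  · exact ⟨(p 0, p 2), (p 1, p 1), by decide⟩

theorem span_mem_goodFinsets : ∀ s t : TwoTorsion, pairing s t = 0 → s ≠ t →
    s ∉ imageFinset → t ∉ imageFinset → s + t ∉ imageFinset →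
      ({0, s, t, s + t} : Finset TwoTorsion) ∈ goodFinsets := by
  decide +kernel

theorem mem_span_of_orthogonal : ∀ s t : TwoTorsion, s ≠ 0 → t ≠ 0 → s ≠ t → pairing s t = 0 →
    ∀ x, pairing s x = 0 → pairing t x = 0 → x ∈ ({0, s, t, s + t} : Finset TwoTorsion) := by
  decide +kernel

/-- The plane spanned by two orthogonal vectors is isotropic. -/
theorem pairing_eq_zero_of_mem_span : ∀ s t : TwoTorsion, pairing s t = 0 →
    ∀ x ∈ ({0, s, t, s + t} : Finset TwoTorsion), ∀ y ∈ ({0, s, t, s + t} : Finset TwoTorsion),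
      pairing x y = 0 := by
  decide +kernel

/-- The multiplicative pairing with values `1` and `-1` on each factor is trivial exactly when
`pairing` vanishes. -/
theorem pairing_eq_zero_iff : ∀ a b : TwoTorsion, pairing a b = 0 ↔
    ((a.1 = 0 ∨ b.1 = 0 ∨ a.1 = b.1) ↔ (a.2 = 0 ∨ b.2 = 0 ∨ a.2 = b.2)) := by
  decide +kernel

section Classification

variable {k : Type*} [Field k] [DecidableEq k] {E₁ E₂ : WeierstrassCurve k}

/-- Coordinates on the `2`-torsion of `E₁ × E₂` that turn the `2`-Weil pairing into `pairing`. -/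
structure IsTorsionCoord (J : TwoTorsion →+ Pts E₁ × Pts E₂) : Prop where
  injective : Function.Injective J
  range : ∀ v, 2 • v = 0 ↔ ∃ a, J a = v
  weil : ∀ a b, weilTwoProd (J a) (J b) = 1 ↔ pairing a b = 0

/-- The numberings of the Weierstrass points provide coordinates on the `2`-torsion. -/
theorem exists_isTorsionCoord [IsAlgClosed k] [E₁.IsElliptic] [E₂.IsElliptic] (h2 : (2 : k) ≠ 0)
    {P : Fin 3 → Pts E₁} {Q : Fin 3 → Pts E₂}
    (hP : IsWeierstrassNumbering E₁ P) (hQ : IsWeierstrassNumbering E₂ Q) :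
    ∃ J : TwoTorsion →+ Pts E₁ × Pts E₂, IsTorsionCoord J ∧
      (∀ i, J (weierstrassCoord i, 0) = (P i, 0)) ∧
      (∀ j, J (0, weierstrassCoord j) = (0, Q j)) ∧
      ∀ i j, J (weierstrassCoord i, weierstrassCoord j) = (P i, Q j) := by
  obtain ⟨ι₁, inj₁, range₁, h₁⟩ := hP.exists_hom
  obtain ⟨ι₂, inj₂, range₂, h₂⟩ := hQ.exists_hom
  have e₁ : ∀ i, ι₁ (weierstrassCoord i) = P i := by
    intro i; fin_cases i
    exacts [h₁.1, h₁.2.1, h₁.2.2]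
  have e₂ : ∀ i, ι₂ (weierstrassCoord i) = Q i := by
    intro i; fin_cases i
    exacts [h₂.1, h₂.2.1, h₂.2.2]
  refine ⟨ι₁.prodMap ι₂, ⟨inj₁.prodMap inj₂, ?_, ?_⟩, fun i => by simp [e₁], fun j => by simp [e₂],
    fun i j => by simp [e₁, e₂]⟩
  · rintro ⟨v, w⟩
    have : 2 • (v, w) = 0 ↔ 2 • v = 0 ∧ 2 • w = 0 := by simp [Prod.ext_iff]
    rw [this, range₁, range₂]
    constructor
    · rintro ⟨⟨a, rfl⟩, b, rfl⟩
      exact ⟨(a, b), rfl⟩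
    · rintro ⟨⟨a, b⟩, h⟩
      exact ⟨⟨a, congrArg Prod.fst h⟩, b, congrArg Prod.snd h⟩
  · intro a b
    have hneg : (-1 : k) ≠ 1 := fun h => h2 (by linear_combination -h)
    rw [pairing_eq_zero_iff, weilTwoProd]
    simp only [AddMonoidHom.coe_prodMap, Prod.map_fst, Prod.map_snd]
    rw [weilTwo_eq h2 (exists_two_nsmul_ne_zero hP) ((range₁ _).2 ⟨_, rfl⟩) ((range₁ _).2 ⟨_, rfl⟩),
      weilTwo_eq h2 (exists_two_nsmul_ne_zero hQ) ((range₂ _).2 ⟨_, rfl⟩) ((range₂ _).2 ⟨_, rfl⟩)]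
    simp only [map_eq_zero_iff _ inj₁, map_eq_zero_iff _ inj₂, inj₁.eq_iff, inj₂.eq_iff]
    split_ifs with c₁ c₂ c₂ <;> simp [c₁, c₂, hneg]

/-- The `(2,2)`-subgroups that meet the plane of `imageFinset` only in `0` are the eight planes of
`goodFinsets`. Maximality costs nothing: an isotropic plane is its own orthogonal complement. -/
theorem IsTorsionCoord.twoTwo_iff {J : TwoTorsion →+ Pts E₁ × Pts E₂} (hJ : IsTorsionCoord J)
    (K : AddSubgroup (Pts E₁ × Pts E₂)) :
    (IsTwoTwoSubgroup K ∧ ∀ n ∈ imageFinset, J n ∈ K → J n = 0) ↔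
      ∃ T ∈ goodFinsets, J '' (T : Set TwoTorsion) = K := by
  have hspan : ∀ s t, J '' (({0, s, t, s + t} : Finset TwoTorsion) : Set TwoTorsion) =
      {0, J s, J t, J s + J t} := fun s t => by
    simp [Set.image_insert_eq]
  have hall : ∀ p : ZMod 2 × ZMod 2, p = 0 ∨ p = (1, 0) ∨ p = (0, 1) ∨ p = (1, 0) + (0, 1) := by
    decide
  constructor
  · rintro ⟨⟨hmax, ⟨e⟩⟩, hN⟩
    have hcoord : ∀ p, ∃ a, J a = (e.symm p : Pts E₁ × Pts E₂) := fun p =>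
      (hJ.range _).1 (hmax.prop.1 _ (e.symm p).2)
    obtain ⟨s, hs⟩ := hcoord (1, 0)
    obtain ⟨t, ht⟩ := hcoord (0, 1)
    have hst : J (s + t) = (e.symm ((1, 0) + (0, 1)) : Pts E₁ × Pts E₂) := by
      rw [map_add, map_add, hs, ht]; rfl
    have hnot : ∀ (p : ZMod 2 × ZMod 2) (a : TwoTorsion), p ≠ 0 →
        J a = (e.symm p : Pts E₁ × Pts E₂) → a ∉ imageFinset := by
      intro p a hp ha hmem
      have h0 := hN a hmem (ha ▸ (e.symm p).2)
      rw [ha] at h0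
      exact hp (by simpa using h0)
    refine ⟨{0, s, t, s + t}, span_mem_goodFinsets s t ?_ ?_ (hnot _ s (by decide) hs)
      (hnot _ t (by decide) ht) (hnot _ _ (by decide) hst), ?_⟩
    · exact (hJ.weil s t).1 (hmax.prop.2 _ (hs ▸ (e.symm _).2) _ (ht ▸ (e.symm _).2))
    · rintro rfl
      have := e.symm.injective (Subtype.ext (hs.symm.trans ht))
      exact absurd this (by decide)
    · rw [hspan]
      ext x
      constructor
      · rintro (rfl | rfl | rfl | rfl)
        · exact K.zero_mem
        · exact hs ▸ (e.symm _).2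
        · exact ht ▸ (e.symm _).2
        · rw [← map_add]; exact hst ▸ (e.symm _).2
      · intro hx
        have hx' : x = (e.symm (e ⟨x, hx⟩) : Pts E₁ × Pts E₂) := by simp
        rw [hx']
        rcases hall (e ⟨x, hx⟩) with h | h | h | h <;> rw [h]
        · simp
        · simp [hs]
        · simp [ht]
        · rw [← hst, map_add]; simp
  · rintro ⟨T, hT, hTK⟩
    obtain ⟨s, t, hs0, ht0, hst, hpair, hs, ht, hst', rfl⟩ := exists_span_of_mem_goodFinsets T hT
    have hmem : ∀ x, x ∈ K ↔ ∃ a ∈ ({0, s, t, s + t} : Finset TwoTorsion), J a = x := fun x => by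
      rw [← SetLike.mem_coe, ← hTK]; rfl
    have hiso : IsIsotropic K := by
      constructor
      · intro x hx
        obtain ⟨a, -, rfl⟩ := (hmem x).1 hx
        exact (hJ.range _).2 ⟨a, rfl⟩
      · intro x hx y hy
        obtain ⟨a, ha, rfl⟩ := (hmem x).1 hx
        obtain ⟨b, hb, rfl⟩ := (hmem y).1 hy
        exact (hJ.weil a b).2 (pairing_eq_zero_of_mem_span s t hpair a ha b hb)
    have hsK : J s ∈ K := (hmem _).2 ⟨s, by simp, rfl⟩
    have htK : J t ∈ K := (hmem _).2 ⟨t, by simp, rfl⟩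
    refine ⟨⟨⟨hiso, ?_⟩, ?_⟩, ?_⟩
    · intro K' hK' hle x hx
      obtain ⟨a, rfl⟩ := (hJ.range _).1 (hK'.1 x hx)
      exact (hmem _).2 ⟨a, mem_span_of_orthogonal s t hs0 ht0 hst hpair a
        ((hJ.weil s a).1 (hK'.2 _ (hle hsK) _ hx)) ((hJ.weil t a).1 (hK'.2 _ (hle htK) _ hx)), rfl⟩
    · obtain ⟨g, hg₁, hg₂⟩ := exists_hom_zmod_prod 2 (J s) (J t) (hiso.1 _ hsK) (hiso.1 _ htK)
      have hne : J s + J t ≠ 0 := fun h => hst' (by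
        rw [← map_add, map_eq_zero_iff _ hJ.injective] at h
        rw [h]; decide)
      have hinj : Function.Injective g := by
        rw [injective_iff_map_eq_zero]
        intro p hp
        rcases hall p with rfl | rfl | rfl | rfl
        · rfl
        · rw [hg₁, map_eq_zero_iff _ hJ.injective] at hp
          exact absurd hp hs0
        · rw [hg₂, map_eq_zero_iff _ hJ.injective] at hp
          exact absurd hp ht0
        · rw [map_add, hg₁, hg₂] at hp
          exact absurd hp hne
      have hrange : g.range = K := by
        ext x
        constructor
        · rintro ⟨p, rfl⟩
          rcases hall p with rfl | rfl | rfl | rfl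
          · rw [map_zero]; exact K.zero_mem
          · exact hg₁ ▸ hsK
          · exact hg₂ ▸ htK
          · rw [map_add, hg₁, hg₂]; exact K.add_mem hsK htK
        · intro hx
          rw [← SetLike.mem_coe, ← hTK, hspan] at hx
          rcases hx with rfl | rfl | rfl | rfl
          · exact ⟨0, map_zero g⟩
          · exact ⟨_, hg₁⟩
          · exact ⟨_, hg₂⟩
          · exact ⟨(1, 0) + (0, 1), by rw [map_add, hg₁, hg₂]⟩
      exact ⟨((AddMonoidHom.ofInjective hinj).trans (AddEquiv.addSubgroupCongr hrange)).symm⟩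
    · intro n hn hnK
      obtain ⟨a, ha, hJa⟩ := (hmem _).1 hnK
      obtain rfl := hJ.injective hJa
      simp only [Finset.mem_insert, Finset.mem_singleton] at ha
      rcases ha with rfl | rfl | rfl | rfl
      · exact map_zero J
      · exact absurd hn hs
      · exact absurd hn ht
      · exact absurd hn hst'

theorem goodKernels_eq_image {P : Fin 3 → Pts E₁} {Q : Fin 3 → Pts E₂}
    {J : TwoTorsion →+ Pts E₁ × Pts E₂}
    (hP : ∀ i, J (weierstrassCoord i, 0) = (P i, 0))
    (hQ : ∀ j, J (0, weierstrassCoord j) = (0, Q j))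
    (hPQ : ∀ i j, J (weierstrassCoord i, weierstrassCoord j) = (P i, Q j)) :
    goodKernels P Q = (fun T : Finset TwoTorsion => J '' (T : Set TwoTorsion)) '' goodFinsets := by
  have h0 : J (0, 0) = (0, 0) := map_zero J
  simp only [goodFinsets, Finset.coe_insert, Finset.coe_singleton, Set.image_insert_eq,
    Set.image_singleton, h0, hP, hQ, hPQ]
  ext S
  simp only [goodKernels, Set.mem_union, Set.mem_insert_iff, Set.mem_singleton_iff]
  constructor
  · rintro (⟨i, j, hi, hj, rfl⟩ | h)
    · fin_cases i <;> fin_cases j <;> simp at hi hj ⊢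
    · tauto
  · rintro (rfl | rfl | rfl | rfl | h)
    · exact Or.inl ⟨1, 1, by decide, by decide, rfl⟩
    · exact Or.inl ⟨1, 2, by decide, by decide, rfl⟩
    · exact Or.inl ⟨2, 1, by decide, by decide, rfl⟩
    · exact Or.inl ⟨2, 2, by decide, by decide, rfl⟩
    · exact Or.inr h

end Classification

/-! ### The preimage of a (2,2)-subgroup under the first isogeny -/

section FirstIsogeny

variable {k : Type*} [Field k] [DecidableEq k] {E₁ E₂ E₁' E₂' : WeierstrassCurve k}

/-- The image of the `2`-torsion of `E₁ × E₂` under the first isogeny. -/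
theorem image_two_torsion {P : Fin 3 → Pts E₁} {Q : Fin 3 → Pts E₂}
    {P' : Fin 3 → Pts E₁'} {Q' : Fin 3 → Pts E₂'}
    (hP : IsWeierstrassNumbering E₁ P) (hQ : IsWeierstrassNumbering E₂ Q)
    {φ : Pts E₁ × Pts E₂ →+ Pts E₁' × Pts E₂'} (hP0 : φ (P 0, 0) = 0) (hQ0 : φ (0, Q 0) = 0)
    (hP1 : φ (P 1, 0) = (P' 0, 0)) (hP2 : φ (P 2, 0) = (P' 0, 0))
    (hQ1 : φ (0, Q 1) = (0, Q' 0)) (hQ2 : φ (0, Q 2) = (0, Q' 0)) :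
    φ '' {v | 2 • v = 0} = {(0, 0), (P' 0, 0), (0, Q' 0), (P' 0, Q' 0)} := by
  have hsum : ∀ v w, φ (v, w) = φ (v, 0) + φ (0, w) := fun v w => by
    rw [← map_add]; simp
  have hP' : ∀ v, 2 • v = 0 → φ (v, 0) = 0 ∨ φ (v, 0) = (P' 0, 0) := fun v hv => by
    by_cases h0 : v = 0
    · exact Or.inl (by rw [h0]; exact map_zero φ)
    · obtain ⟨i, rfl⟩ := (Set.ext_iff.mp hP.2 v).mpr ⟨h0, hv⟩
      fin_cases i
      exacts [Or.inl hP0, Or.inr hP1, Or.inr hP2]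
  have hQ' : ∀ v, 2 • v = 0 → φ (0, v) = 0 ∨ φ (0, v) = (0, Q' 0) := fun v hv => by
    by_cases h0 : v = 0
    · exact Or.inl (by rw [h0]; exact map_zero φ)
    · obtain ⟨i, rfl⟩ := (Set.ext_iff.mp hQ.2 v).mpr ⟨h0, hv⟩
      fin_cases i
      exacts [Or.inl hQ0, Or.inr hQ1, Or.inr hQ2]
  have hP1t : 2 • P 1 = 0 := ((Set.ext_iff.mp hP.2 _).mp (Set.mem_range_self 1)).2
  have hQ1t : 2 • Q 1 = 0 := ((Set.ext_iff.mp hQ.2 _).mp (Set.mem_range_self 1)).2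
  ext x
  constructor
  · rintro ⟨⟨v, w⟩, hvw, rfl⟩
    have hv : 2 • v = 0 := congrArg Prod.fst hvw
    have hw : 2 • w = 0 := congrArg Prod.snd hvw
    rw [hsum]
    rcases hP' v hv with h | h <;> rcases hQ' w hw with h' | h' <;> simp [h, h', Prod.zero_eq_mk]
  · rintro (rfl | rfl | rfl | rfl)
    · exact ⟨0, smul_zero 2, map_zero φ⟩
    · exact ⟨(P 1, 0), Prod.ext hP1t (smul_zero 2), hP1⟩
    · exact ⟨(0, Q 1), Prod.ext (smul_zero 2) hQ1t, hQ1⟩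
    · exact ⟨(P 1, Q 1), Prod.ext hP1t hQ1t, by rw [hsum, hP1, hQ1]; simp⟩

end FirstIsogeny

end Isog

theorem mainTheorem6 {k : Type*} [Field k] [IsAlgClosed k] [DecidableEq k] (h2 : (2 : k) ≠ 0)
    (E₁ E₂ E₁' E₂' : WeierstrassCurve k)
    [E₁.IsElliptic] [E₂.IsElliptic] [E₁'.IsElliptic] [E₂'.IsElliptic]
    (P : Fin 3 → Isog.Pts E₁) (Q : Fin 3 → Isog.Pts E₂)
    (P' : Fin 3 → Isog.Pts E₁') (Q' : Fin 3 → Isog.Pts E₂')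
    (hP : Isog.IsWeierstrassNumbering E₁ P) (hQ : Isog.IsWeierstrassNumbering E₂ Q)
    (hP' : Isog.IsWeierstrassNumbering E₁' P') (hQ' : Isog.IsWeierstrassNumbering E₂' Q')
    (φ₁ : Isog.Pts E₁ × Isog.Pts E₂ →+ Isog.Pts E₁' × Isog.Pts E₂')
    (hφ₁ : Isog.IsTwoTwoIsogeny φ₁)
    (hker : (φ₁.ker : Set (Isog.Pts E₁ × Isog.Pts E₂)) =
      {(0, 0), (P 0, 0), (0, Q 0), (P 0, Q 0)})
    (hP1 : φ₁ (P 1, 0) = (P' 0, 0)) (hP2 : φ₁ (P 2, 0) = (P' 0, 0))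
    (hQ1 : φ₁ (0, Q 1) = (0, Q' 0)) (hQ2 : φ₁ (0, Q 2) = (0, Q' 0)) :
    -- the isogenies `φ₂` out of `E₁' × E₂'` that are good extensions of `φ₁`
    (∀ (A₂ : Type*) [AddCommGroup A₂] [Isog.ProjCoords k A₂], Isog.IsAbelianVariety k A₂ →
      ∀ φ₂ : Isog.Pts E₁' × Isog.Pts E₂' →+ A₂,
        Isog.IsGoodExtension φ₁ φ₂ ↔
          Isog.IsSeparableIsogeny k φ₂ ∧
            (φ₂.ker : Set (Isog.Pts E₁' × Isog.Pts E₂')) ∈ Isog.goodKernels P' Q') ∧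
    -- the same for the corresponding `(2,2)`-subgroups `K` of `E₁' × E₂'`
    {S : Set (Isog.Pts E₁' × Isog.Pts E₂') |
      ∃ K : AddSubgroup (Isog.Pts E₁' × Isog.Pts E₂'), (K : Set _) = S ∧
        Isog.IsTwoTwoSubgroup K ∧ Nonempty (K.comap φ₁ ≃+ ZMod 4 × ZMod 4)} =
      Isog.goodKernels P' Q' ∧
    (Isog.goodKernels P' Q').ncard = 8 := by
  obtain ⟨J, hJ, hJP, hJQ, hJPQ⟩ := Isog.exists_isTorsionCoord h2 hP' hQ'
  have hmemker : ∀ v, φ₁ v = 0 ↔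
      v ∈ ({(0, 0), (P 0, 0), (0, Q 0), (P 0, Q 0)} : Set (Isog.Pts E₁ × Isog.Pts E₂)) := by
    intro v
    rw [← hker]; rfl
  have hPt := (Set.ext_iff.mp hP.2 _).mp (Set.mem_range_self 0)
  have hQt := (Set.ext_iff.mp hQ.2 _).mp (Set.mem_range_self 0)
  have hkertwo : ∀ v, φ₁ v = 0 → 2 • v = 0 := by
    intro v hv
    rcases (hmemker v).1 hv with rfl | rfl | rfl | rfl
    · exact smul_zero 2
    · exact Prod.ext hPt.2 (smul_zero 2)
    · exact Prod.ext (smul_zero 2) hQt.2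
    · exact Prod.ext hPt.2 hQt.2
  have hcard : (φ₁.ker : Set (Isog.Pts E₁ × Isog.Pts E₂)).ncard = 4 := by
    have h0 := hPt.1
    have h0' := hQt.1
    rw [hker, Set.ncard_insert_of_notMem, Set.ncard_insert_of_notMem, Set.ncard_pair] <;>
      simp [h0, Ne.symm h0, Ne.symm h0']
  have himage := Isog.image_two_torsion (P' := P') (Q' := Q') hP hQ
    ((hmemker _).2 (by simp)) ((hmemker _).2 (by simp)) hP1 hP2 hQ1 hQ2
  have himageJ : φ₁ '' {v | 2 • v = 0} = J '' (Isog.imageFinset : Set Isog.TwoTorsion) := by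
    have h1 : J (0, 0) = (0, 0) := map_zero J
    have h5 : J ((1, 0), 0) = (P' 0, 0) := hJP 0
    have h3 : J (0, (1, 0)) = (0, Q' 0) := hJQ 0
    have h4 : J ((1, 0), (1, 0)) = (P' 0, Q' 0) := hJPQ 0 0
    simp only [himage, Isog.imageFinset, Finset.coe_insert, Finset.coe_singleton,
      Set.image_insert_eq, Set.image_singleton, Prod.mk_zero_zero] at h1 h5 h3 h4 ⊢
    rw [h1, h5, h3, h4]
  have hgood := Isog.goodKernels_eq_image hJP hJQ hJPQ
  have main : ∀ K : AddSubgroup (Isog.Pts E₁' × Isog.Pts E₂'),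
      Isog.IsTwoTwoSubgroup K ∧ Nonempty (K.comap φ₁ ≃+ ZMod 4 × ZMod 4) ↔
        (K : Set (Isog.Pts E₁' × Isog.Pts E₂')) ∈ Isog.goodKernels P' Q' := by
    intro K
    have hiff : (K : Set (Isog.Pts E₁' × Isog.Pts E₂')) ∈ Isog.goodKernels P' Q' ↔
        Isog.IsTwoTwoSubgroup K ∧ ∀ n ∈ Isog.imageFinset, J n ∈ K → J n = 0 := by
      rw [hgood]
      exact (hJ.twoTwo_iff K).symm
    rw [hiff]
    refine and_congr_right fun hK => ?_
    obtain ⟨e⟩ := hK.2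
    rw [Isog.comap_equiv_zmod_four_iff φ₁ hφ₁.1.surjective hcard hkertwo K e]
    constructor
    · intro h n hn hnK
      obtain ⟨v, hv, hvn⟩ := himageJ.ge ⟨n, hn, rfl⟩
      rw [← hvn] at hnK ⊢
      exact h v hv hnK
    · intro h v hv hvK
      obtain ⟨n, hn, hnv⟩ := himageJ.le ⟨v, hv, rfl⟩
      rw [← hnv] at hvK ⊢
      exact h n hn hvK
  refine ⟨?_, ?_, ?_⟩
  · intro A₂ _ _ _ φ₂
    rw [← main φ₂.ker, AddMonoidHom.comap_ker]
    exact ⟨fun h => ⟨h.2.1.1, h.2.1.2, h.2.2⟩, fun h => ⟨hφ₁, ⟨h.1, h.2.1⟩, h.2.2⟩⟩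
  · ext S
    constructor
    · rintro ⟨K, rfl, hK⟩
      exact (main K).1 hK
    · intro hS
      -- each of the eight sets is closed under addition, being the image of a plane
      obtain ⟨T, hT, hTS⟩ := hgood.le hS
      obtain ⟨s, t, -, -, -, -, -, -, -, rfl⟩ := Isog.exists_span_of_mem_goodFinsets T hT
      obtain ⟨g, hg₁, hg₂⟩ := Isog.exists_hom_zmod_prod 2 (J s) (J t)
        ((hJ.range _).2 ⟨s, rfl⟩) ((hJ.range _).2 ⟨t, rfl⟩)
      have hgS : (g.range : Set (Isog.Pts E₁' × Isog.Pts E₂')) = S := by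
        have huniv : (Set.univ : Set (ZMod 2 × ZMod 2)) = {0, (1, 0), (0, 1), (1, 0) + (0, 1)} := by
          refine (Set.eq_univ_of_forall ?_).symm
          decide
        rw [← hTS, AddMonoidHom.coe_range, ← Set.image_univ, huniv]
        simp only [Set.image_insert_eq, Set.image_singleton, map_add, map_zero, hg₁, hg₂,
          Finset.coe_insert, Finset.coe_singleton]
      exact ⟨g.range, hgS, (main _).2 (hgS ▸ hS)⟩
  · rw [hgood, Set.ncard_image_of_injective, Set.ncard_coe_finset, Isog.card_goodFinsets]
    intro T T' h
    exact Finset.coe_injective (hJ.injective.image_injective h)
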